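/- Let $(M,h,P)$ and $(N,g,Q)$ be almost product manifolds: $M$ and $N$ are smooth finite-dimensional manifolds, $P$ and $Q$ are smooth $(1,1)$-tensor fields with $P^2=I$ and $Q^2=I$, and $h$, $g$ are smooth nondegenerate (semi-Riemannian, in particular possibly Riemannian) metrics with Levi-Civita connections $\overset{M}{\nabla}$, $\overset{N}{\nabla}$. Assume that $h$ is pure, $h(PX,Y)=h(X,PY)$, or hyperbolic, $h(PX,Y)=-h(X,PY)$, with respect to $P$, and that $g$ is pure or hyperbolic with respect to $Q$. For $X,Y$ put $(\nabla_XP)Y=\nabla_X(PY)-P(\nabla_XY)$ and $S_P(X,Y)=(\nabla_XP)Y+P\big((\nabla_{PX}P)Y\big)$, and likewise for $Q$ on $N$. Let $F:M\to N$ be a smooth map with differential $F_*$ which is $\pm(P,Q)$-paraholomorphic, i.e. $F_*\circ P=\lambda\,Q\circ F_*$ with $\lambda=1$ (paraholomorphic) or $\lambda=-1$ (anti-paraholomorphic). Its second fundamental form is $$(\nabla F_*)(X,Y)=\overset{N}{\nabla}_{F_*X}(F_*Y)-F_*\big(\overset{M}{\nabla}_XY\big),$$ where $\overset{N}{\nabla}_{F_*X}$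 acts on vector fields along $F$ as the pull-back along $F$ of the Levi-Civita connection of $N$. Then for all smooth local sections $X,Y$ of $TM$, with $X'=F_*X$ and $Y'=F_*Y$, $$(\nabla F_*)(PX,PY)=(\nabla F_*)(X,Y)+\big(\overset{N}{\nabla}_{QX'}Q\big)Y'-\big(\overset{N}{\nabla}_{Y'}Q\big)(QX')-F_*\Big[\big(\overset{M}{\nabla}_{PX}P\big)Y-\big(\overset{M}{\nabla}_{Y}P\big)(PX)\Big].$$ In particular, $$(\nabla F_*)(PX,PX)=(\nabla F_*)(X,X)+S_Q(QX',X')-F_*\big[S_P(PX,X)\big]=(\nabla F_*)(X,X)+Q\big\{S_Q(X',X')-\lambda F_*[S_P(X,X)]\big\}.$$ -/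

import Mathlib

open Bundle FiberBundle VectorField
open scoped Manifold ContDiff Topology

noncomputable section

section Structures

variable {E : Type*} [NormedAddCommGroup E] [NormedSpace ℝ E]
  {H : Type*} [TopologicalSpace H] (I : ModelWithCorners ℝ E H)
  (M : Type*) [TopologicalSpace M] [ChartedSpace H M] [IsManifold I ∞ M]

/-- A (semi-)Riemannian metric on `M`: a smooth symmetric `(0,2)`-tensor field which is
nondegenerate at every point (no condition on the signature). -/
structure SemiRiemannianMetric where
  /-- The scalar product `h(v, w)` of two tangent vectors at `x`. -/
  inner (x : M) : TangentSpace I x →L[ℝ] TangentSpace I x →L[ℝ] ℝ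
  symm (x : M) (v w : TangentSpace I x) : inner x v w = inner x w v
  nondegenerate (x : M) (v : TangentSpace I x) : (∀ w, inner x v w = 0) → v = 0
  contMDiff : ContMDiff I (I.prod 𝓘(ℝ, E →L[ℝ] E →L[ℝ] ℝ)) ∞
    (fun x ↦ TotalSpace.mk' (E →L[ℝ] E →L[ℝ] ℝ)
      (E := fun x : M ↦ TangentSpace I x →L[ℝ] TangentSpace I x →L[ℝ] ℝ) x (inner x))

/-- An almost product structure on `M`: a smooth `(1,1)`-tensor field `P` with `P² = Id`. -/
structure AlmostProductStructure where
  /-- The endomorphism of the tangent space at `x`. -/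
  toFun (x : M) : TangentSpace I x →L[ℝ] TangentSpace I x
  sq (x : M) (v : TangentSpace I x) : toFun x (toFun x v) = v
  contMDiff : ContMDiff I (I.prod 𝓘(ℝ, E →L[ℝ] E)) ∞
    (fun x ↦ TotalSpace.mk' (E →L[ℝ] E)
      (E := fun x : M ↦ TangentSpace I x →L[ℝ] TangentSpace I x) x (toFun x))

end Structures

section Compatibility

variable {E : Type*} [NormedAddCommGroup E] [NormedSpace ℝ E]
  {H : Type*} [TopologicalSpace H] {I : ModelWithCorners ℝ E H}
  {M : Type*} [TopologicalSpace M] [ChartedSpace H M] [IsManifold I ∞ M]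

instance : CoeFun (AlmostProductStructure I M)
    (fun _ ↦ ∀ x : M, TangentSpace I x →L[ℝ] TangentSpace I x) :=
  ⟨AlmostProductStructure.toFun⟩

/-- The metric `h` is pure with respect to `P`: `h(PX, Y) = h(X, PY)`. -/
def IsPure (h : SemiRiemannianMetric I M) (P : AlmostProductStructure I M) : Prop :=
  ∀ (x : M) (v w : TangentSpace I x), h.inner x (P x v) w = h.inner x v (P x w)

/-- The metric `h` is hyperbolic with respect to `P`: `h(PX, Y) = h(X, -PY)`. -/
def IsHyperbolic (h : SemiRiemannianMetric I M) (P : AlmostProductStructure I M) : Prop :=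
  ∀ (x : M) (v w : TangentSpace I x), h.inner x (P x v) w = h.inner x v (-P x w)

lemma AlmostProductStructure.mdiff_apply (P : AlmostProductStructure I M)
    {Y : Π x : M, TangentSpace I x} {x : M} (hY : MDiffAt (T% Y) x) :
    MDiffAt (T% (fun y ↦ P y (Y y))) x :=
  MDifferentiableAt.clm_bundle_apply (F₁ := E) (F₂ := E) (b := fun y : M ↦ y) (ϕ := P.toFun)
    ((P.contMDiff x).mdifferentiableAt (by simp)) hY

end Compatibility

section LeviCivita

variable {E : Type*} [NormedAddCommGroup E] [NormedSpace ℝ E]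
  {H : Type*} [TopologicalSpace H] {I : ModelWithCorners ℝ E H}
  {M : Type*} [TopologicalSpace M] [ChartedSpace H M] [IsManifold I ∞ M]

namespace SemiRiemannianMetric

variable (h : SemiRiemannianMetric I M)

/-- The right-hand side of the Koszul formula for `2 h(∇_X Y, Z)`. -/
def koszul (X Y Z : Π x : M, TangentSpace I x) (x : M) : ℝ :=
  d% (fun y ↦ h.inner y (Y y) (Z y)) x (X x)
    + d% (fun y ↦ h.inner y (X y) (Z y)) x (Y x)
    - d% (fun y ↦ h.inner y (X y) (Y y)) x (Z x)
    + h.inner x (mlieBracket I X Y x) (Z x)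
    - h.inner x (mlieBracket I X Z x) (Y x)
    - h.inner x (mlieBracket I Y Z x) (X x)

variable {h} {X Y Z X' Y' Z' : Π x : M, TangentSpace I x} {x : M} {f : M → ℝ}

lemma mdiff_inner (hX : MDiffAt (T% X) x) (hY : MDiffAt (T% Y) x) :
    MDiffAt (fun y ↦ h.inner y (X y) (Y y)) x := by
  have := MDifferentiableAt.clm_bundle_apply₂ (F₁ := E) (F₂ := E) (F₃ := ℝ)
    (E₃ := Bundle.Trivial M ℝ)
    (b := fun y : M ↦ y) (ψ := h.inner)
    ((h.contMDiff x).mdifferentiableAt (by simp)) hX hY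
  simp only [mdifferentiableAt_totalSpace] at this
  exact this.2

lemma koszul_add₁ [FiniteDimensional ℝ E] (hX : MDiffAt (T% X) x) (hX' : MDiffAt (T% X') x)
    (hY : MDiffAt (T% Y) x) (hZ : MDiffAt (T% Z) x) :
    h.koszul (X + X') Y Z x = h.koszul X Y Z x + h.koszul X' Y Z x := by
  have := FiniteDimensional.complete ℝ E
  have e1 : (fun y ↦ h.inner y ((X + X') y) (Z y))
      = (fun y ↦ h.inner y (X y) (Z y)) + fun y ↦ h.inner y (X' y) (Z y) := by
    ext; simp
  have e2 : (fun y ↦ h.inner y ((X + X') y) (Y y))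
      = (fun y ↦ h.inner y (X y) (Y y)) + fun y ↦ h.inner y (X' y) (Y y) := by
    ext; simp
  simp only [koszul, e1, e2, mlieBracket_add_left hX hX',
    mvfderiv_add (mdiff_inner (h := h) hX hZ) (mdiff_inner (h := h) hX' hZ),
    mvfderiv_add (mdiff_inner (h := h) hX hY) (mdiff_inner (h := h) hX' hY)]
  simp
  ring

lemma koszul_smul₁ [FiniteDimensional ℝ E] (hf : MDiffAt f x) (hX : MDiffAt (T% X) x)
    (hY : MDiffAt (T% Y) x) (hZ : MDiffAt (T% Z) x) :
    h.koszul (f • X) Y Z x = f x * h.koszul X Y Z x := by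
  have := FiniteDimensional.complete ℝ E
  have e1 : (fun y ↦ h.inner y ((f • X) y) (Z y))
      = f * (fun y ↦ h.inner y (X y) (Z y)) := by
    ext; simp
  have e2 : (fun y ↦ h.inner y ((f • X) y) (Y y))
      = f * (fun y ↦ h.inner y (X y) (Y y)) := by
    ext; simp
  simp only [koszul, e1, e2, mlieBracket_smul_left hf hX,
    mvfderiv_mul hf (mdiff_inner (h := h) hX hZ),
    mvfderiv_mul hf (mdiff_inner (h := h) hX hY)]
  simp
  ring

lemma koszul_add₃ [FiniteDimensional ℝ E] (hX : MDiffAt (T% X) x)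
    (hY : MDiffAt (T% Y) x) (hZ : MDiffAt (T% Z) x) (hZ' : MDiffAt (T% Z') x) :
    h.koszul X Y (Z + Z') x = h.koszul X Y Z x + h.koszul X Y Z' x := by
  have := FiniteDimensional.complete ℝ E
  have e1 : (fun y ↦ h.inner y (X y) ((Z + Z') y))
      = (fun y ↦ h.inner y (X y) (Z y)) + fun y ↦ h.inner y (X y) (Z' y) := by
    ext; simp
  have e2 : (fun y ↦ h.inner y (Y y) ((Z + Z') y))
      = (fun y ↦ h.inner y (Y y) (Z y)) + fun y ↦ h.inner y (Y y) (Z' y) := by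
    ext; simp
  simp only [koszul, e1, e2, mlieBracket_add_right hZ hZ',
    mvfderiv_add (mdiff_inner (h := h) hX hZ) (mdiff_inner (h := h) hX hZ'),
    mvfderiv_add (mdiff_inner (h := h) hY hZ) (mdiff_inner (h := h) hY hZ')]
  simp
  ring

lemma koszul_smul₃ [FiniteDimensional ℝ E] (hf : MDiffAt f x) (hX : MDiffAt (T% X) x)
    (hY : MDiffAt (T% Y) x) (hZ : MDiffAt (T% Z) x) :
    h.koszul X Y (f • Z) x = f x * h.koszul X Y Z x := by
  have := FiniteDimensional.complete ℝ E
  have e1 : (fun y ↦ h.inner y (X y) ((f • Z) y))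
      = f * (fun y ↦ h.inner y (X y) (Z y)) := by
    ext; simp
  have e2 : (fun y ↦ h.inner y (Y y) ((f • Z) y))
      = f * (fun y ↦ h.inner y (Y y) (Z y)) := by
    ext; simp
  simp only [koszul, e1, e2, mlieBracket_smul_right hf hZ,
    mvfderiv_mul hf (mdiff_inner (h := h) hX hZ),
    mvfderiv_mul hf (mdiff_inner (h := h) hY hZ)]
  simp [h.symm x (Z x)]
  ring

lemma koszul_add₂ [FiniteDimensional ℝ E] (hX : MDiffAt (T% X) x)
    (hY : MDiffAt (T% Y) x) (hY' : MDiffAt (T% Y') x) (hZ : MDiffAt (T% Z) x) :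
    h.koszul X (Y + Y') Z x = h.koszul X Y Z x + h.koszul X Y' Z x := by
  have := FiniteDimensional.complete ℝ E
  have e1 : (fun y ↦ h.inner y ((Y + Y') y) (Z y))
      = (fun y ↦ h.inner y (Y y) (Z y)) + fun y ↦ h.inner y (Y' y) (Z y) := by
    ext; simp
  have e2 : (fun y ↦ h.inner y (X y) ((Y + Y') y))
      = (fun y ↦ h.inner y (X y) (Y y)) + fun y ↦ h.inner y (X y) (Y' y) := by
    ext; simp
  simp only [koszul, e1, e2, mlieBracket_add_left hY hY', mlieBracket_add_right hY hY',
    mvfderiv_add (mdiff_inner (h := h) hY hZ) (mdiff_inner (h := h) hY' hZ),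
    mvfderiv_add (mdiff_inner (h := h) hX hY) (mdiff_inner (h := h) hX hY')]
  simp
  ring

lemma koszul_smul₂ [FiniteDimensional ℝ E] (hf : MDiffAt f x) (hX : MDiffAt (T% X) x)
    (hY : MDiffAt (T% Y) x) (hZ : MDiffAt (T% Z) x) :
    h.koszul X (f • Y) Z x
      = f x * h.koszul X Y Z x + 2 * (d% f x (X x) * h.inner x (Y x) (Z x)) := by
  have := FiniteDimensional.complete ℝ E
  have e1 : (fun y ↦ h.inner y ((f • Y) y) (Z y))
      = f * (fun y ↦ h.inner y (Y y) (Z y)) := by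
    ext; simp
  have e2 : (fun y ↦ h.inner y (X y) ((f • Y) y))
      = f * (fun y ↦ h.inner y (X y) (Y y)) := by
    ext; simp
  simp only [koszul, e1, e2, mlieBracket_smul_left hf hY, mlieBracket_smul_right hf hY,
    mvfderiv_mul hf (mdiff_inner (h := h) hY hZ),
    mvfderiv_mul hf (mdiff_inner (h := h) hX hY)]
  simp [h.symm x (Y x) (X x)]
  ring

variable (h)

/-- For a vector field `Y` differentiable at `x`, the bilinear form
`(X, Z) ↦ 2 h(∇_X Y, Z)` on the tangent space at `x` given by the Koszul formula. -/
def koszulForm [FiniteDimensional ℝ E] (Y : Π x : M, TangentSpace I x) (x : M)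
    (hY : MDiffAt (T% Y) x) : TangentSpace I x →L[ℝ] TangentSpace I x →L[ℝ] ℝ :=
  TensorialAt.mkHom₂ (I := I) (F := E) (F' := E) (fun X Z ↦ h.koszul X Y Z x) x
    (fun _ hZ ↦ ⟨fun hf hX ↦ koszul_smul₁ hf hX hY hZ, fun hX hX' ↦ koszul_add₁ hX hX' hY hZ⟩)
    (fun _ hX ↦ ⟨fun hf hZ ↦ koszul_smul₃ hf hX hY hZ, fun hZ hZ' ↦ koszul_add₃ hX hY hZ hZ'⟩)

variable {h} in
lemma koszulForm_apply [FiniteDimensional ℝ E] (hX : MDiffAt (T% X) x)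
    (hY : MDiffAt (T% Y) x) (hZ : MDiffAt (T% Z) x) :
    h.koszulForm Y x hY (X x) (Z x) = h.koszul X Y Z x :=
  TensorialAt.mkHom₂_apply _ _ hX hZ

/-- The isomorphism from the tangent space to its dual defined by the metric. -/
def flat [FiniteDimensional ℝ E] (x : M) :
    TangentSpace I x ≃ₗ[ℝ] (TangentSpace I x →L[ℝ] ℝ) :=
  haveI : FiniteDimensional ℝ (TangentSpace I x) := inferInstanceAs (FiniteDimensional ℝ E)
  haveI : T2Space (TangentSpace I x) := inferInstanceAs (T2Space E)
  LinearEquiv.ofInjectiveOfFinrankEq (h.inner x).toLinearMap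
    (by
      rw [injective_iff_map_eq_zero]
      intro v hv
      exact h.nondegenerate x v fun w ↦ by simpa using congr($hv w))
    (by
      have e : (TangentSpace I x →ₗ[ℝ] ℝ) ≃ₗ[ℝ] (TangentSpace I x →L[ℝ] ℝ) :=
        LinearMap.toContinuousLinearMap
      exact (Subspace.dual_finrank_eq (K := ℝ) (V := TangentSpace I x)).symm.trans e.finrank_eq)

open scoped Classical in
/-- `∇Y` at `x`, as the linear map `v ↦ ∇_v Y`, determined by the Koszul formula
(and set to `0` if `Y` is not differentiable at `x`). -/
def leviCivitaFun [FiniteDimensional ℝ E] (Y : Π x : M, TangentSpace I x) (x : M) :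
    TangentSpace I x →L[ℝ] TangentSpace I x :=
  haveI : FiniteDimensional ℝ (TangentSpace I x) := inferInstanceAs (FiniteDimensional ℝ E)
  haveI : T2Space (TangentSpace I x) := inferInstanceAs (T2Space E)
  if hY : MDiffAt (T% Y) x then
    LinearMap.toContinuousLinearMap
      ((h.flat x).symm.toLinearMap ∘ₗ ((2⁻¹ : ℝ) • (h.koszulForm Y x hY).toLinearMap))
  else 0

variable {h} in
lemma inner_leviCivitaFun [FiniteDimensional ℝ E] (hY : MDiffAt (T% Y) x)
    (v w : TangentSpace I x) :
    h.inner x (h.leviCivitaFun Y x v) w = 2⁻¹ * h.koszulForm Y x hY v w := by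
  have key : h.flat x (h.leviCivitaFun Y x v) = (2⁻¹ : ℝ) • h.koszulForm Y x hY v := by
    simp [leviCivitaFun, hY]
  exact congr($key w)

variable {h} in
lemma ext_inner {v v' : TangentSpace I x} (H : ∀ w, h.inner x v w = h.inner x v' w) : v = v' :=
  sub_eq_zero.1 (h.nondegenerate x _ fun w ↦ by simp [H w])

/-- The Levi-Civita connection of a semi-Riemannian metric. Following Mathlib's convention for
covariant derivatives, `h.leviCivita Y x v` is `(∇_v Y)(x)`. -/
def leviCivita [FiniteDimensional ℝ E] :
    CovariantDerivative I E (TangentSpace I : M → Type _) where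
  toFun := h.leviCivitaFun
  isCovariantDerivativeOnUniv :=
    { add := by
        intro Y Y' x hY hY' _
        ext v
        refine ext_inner (h := h) fun w ↦ ?_
        have hX := mdifferentiableAt_extend (I := I) (F := E) v
        have hZ := mdifferentiableAt_extend (I := I) (F := E) w
        have hYY := mdifferentiableAt_add_section hY hY'
        have k := koszul_add₂ (h := h) hX hY hY' hZ
        rw [← koszulForm_apply hX hYY hZ, ← koszulForm_apply hX hY hZ,
          ← koszulForm_apply hX hY' hZ] at k
        simp only [extend_apply_self] at k
        simp [inner_leviCivitaFun hYY, inner_leviCivitaFun hY, inner_leviCivitaFun hY', k]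
        ring
      leibniz := by
        intro Y f x hY hf _
        ext v
        refine ext_inner (h := h) fun w ↦ ?_
        have hX := mdifferentiableAt_extend (I := I) (F := E) v
        have hZ := mdifferentiableAt_extend (I := I) (F := E) w
        have hfY := hf.smul_section hY
        have k := koszul_smul₂ (h := h) hf hX hY hZ
        rw [← koszulForm_apply hX hfY hZ, ← koszulForm_apply hX hY hZ] at k
        simp only [extend_apply_self] at k
        simp [inner_leviCivitaFun hfY, inner_leviCivitaFun hY, k]
        ring }

variable {h} in
lemma inner_leviCivita [FiniteDimensional ℝ E] (hX : MDiffAt (T% X) x)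
    (hY : MDiffAt (T% Y) x) (hZ : MDiffAt (T% Z) x) :
    h.inner x (h.leviCivita Y x (X x)) (Z x) = 2⁻¹ * h.koszul X Y Z x := by
  rw [← koszulForm_apply hX hY hZ]
  exact inner_leviCivitaFun hY _ _

/-- The Levi-Civita connection is torsion-free. -/
lemma leviCivita_torsion [FiniteDimensional ℝ E] (hX : MDiffAt (T% X) x)
    (hY : MDiffAt (T% Y) x) :
    h.leviCivita Y x (X x) - h.leviCivita X x (Y x) = mlieBracket I X Y x := by
  refine ext_inner (h := h) fun w ↦ ?_
  have hZ := mdifferentiableAt_extend (I := I) (F := E) w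
  have k1 := inner_leviCivita (h := h) hX hY hZ
  have k2 := inner_leviCivita (h := h) hY hX hZ
  have e : (fun y ↦ h.inner y (Y y) (X y)) = fun y ↦ h.inner y (X y) (Y y) := by
    ext y; exact h.symm y _ _
  simp only [koszul, e, mlieBracket_swap_apply (V := Y) (W := X), extend_apply_self] at k1 k2
  simp [k1, k2]
  ring

/-- The Levi-Civita connection is compatible with the metric. -/
lemma leviCivita_metric [FiniteDimensional ℝ E] (hX : MDiffAt (T% X) x)
    (hY : MDiffAt (T% Y) x) (hZ : MDiffAt (T% Z) x) :
    d% (fun y ↦ h.inner y (Y y) (Z y)) x (X x)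
      = h.inner x (h.leviCivita Y x (X x)) (Z x) + h.inner x (Y x) (h.leviCivita Z x (X x)) := by
  rw [h.symm x (Y x), inner_leviCivita hX hY hZ, inner_leviCivita hX hZ hY]
  have e : (fun y ↦ h.inner y (Z y) (Y y)) = fun y ↦ h.inner y (Y y) (Z y) := by
    ext y; exact h.symm y _ _
  simp only [koszul, e, mlieBracket_swap_apply (V := Z) (W := Y)]
  simp
  ring

end SemiRiemannianMetric
end LeviCivita

section Maps

set_option linter.unusedSectionVars false

variable {E : Type*} [NormedAddCommGroup E] [NormedSpace ℝ E] [FiniteDimensional ℝ E]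
  {H : Type*} [TopologicalSpace H] {I : ModelWithCorners ℝ E H}
  {M : Type*} [TopologicalSpace M] [ChartedSpace H M] [IsManifold I ∞ M]
  {E' : Type*} [NormedAddCommGroup E'] [NormedSpace ℝ E'] [FiniteDimensional ℝ E']
  {H' : Type*} [TopologicalSpace H'] {I' : ModelWithCorners ℝ E' H'}
  {N : Type*} [TopologicalSpace N] [ChartedSpace H' N] [IsManifold I' ∞ N]

lemma nablaStructure_tensorial (h : SemiRiemannianMetric I M) (P : AlmostProductStructure I M)
    (x : M) :
    TensorialAt I E (fun Y : Π x : M, TangentSpace I x ↦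
      h.leviCivita (fun y ↦ P y (Y y)) x - (P x) ∘L (h.leviCivita Y x)) x where
  smul := by
    intro f Y hf hY
    have e : (fun y ↦ P y ((f • Y) y)) = f • fun y ↦ P y (Y y) := by ext y; simp
    rw [e, h.leviCivita.isCovariantDerivativeOn.leibniz (P.mdiff_apply hY) hf,
      h.leviCivita.isCovariantDerivativeOn.leibniz hY hf]
    ext v
    simp
    module
  add := by
    intro Y Y' hY hY'
    have e : (fun y ↦ P y ((Y + Y') y)) = (fun y ↦ P y (Y y)) + fun y ↦ P y (Y' y) := by
      ext y; simp
    rw [e, h.leviCivita.isCovariantDerivativeOn.add (P.mdiff_apply hY) (P.mdiff_apply hY'),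
      h.leviCivita.isCovariantDerivativeOn.add hY hY']
    ext v
    simp
    module

/-- The covariant derivative `∇P` of an almost product structure with respect to the Levi-Civita
connection, as a tensor: `nablaStructure h P x v w = (∇_v P) w`, where
`(∇_X P) Y = ∇_X (P Y) - P (∇_X Y)`. -/
def nablaStructure (h : SemiRiemannianMetric I M) (P : AlmostProductStructure I M) (x : M)
    (v w : TangentSpace I x) : TangentSpace I x :=
  TensorialAt.mkHom _ x (nablaStructure_tensorial h P x) w v

lemma nablaStructure_apply (h : SemiRiemannianMetric I M) (P : AlmostProductStructure I M)
    {x : M} (v : TangentSpace I x) {Y : Π x : M, TangentSpace I x} (hY : MDiffAt (T% Y) x) :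
    nablaStructure h P x v (Y x)
      = h.leviCivita (fun y ↦ P y (Y y)) x v - P x (h.leviCivita Y x v) := by
  simp [nablaStructure, TensorialAt.mkHom_apply (nablaStructure_tensorial h P x) hY]

/-- The tensor `S_P(v, w) = (∇_v P) w + P ((∇_{P v} P) w)`. -/
def tensorS (h : SemiRiemannianMetric I M) (P : AlmostProductStructure I M) (x : M)
    (v w : TangentSpace I x) : TangentSpace I x :=
  nablaStructure h P x v w + P x (nablaStructure h P x (P x v) w)

/-- The covariant derivative `∇^N_{F_* v} V` of a vector field `V` along `F : M → N` in the
direction `v ∈ T_x M`, that is, the pull-back to `F` of the Levi-Civita connection of `N`.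
In terms of the frame `(e_k)` of `TN` given by the preferred trivialization at `F x`, write
`V = ∑ V^k (e_k ∘ F)`; then the value is `∑ dV^k(v) e_k + ∑ V^k(x) ∇^N_{F_* v} e_k`. The first sum
is the first term below; in the second, `extend E' (V x) = ∑ V^k(x) e_k`. -/
def covDerivAlong (I : ModelWithCorners ℝ E H) [IsManifold I ∞ M] (g : SemiRiemannianMetric I' N)
    (F : M → N) (V : Π x : M, TangentSpace I' (F x)) (x : M) (v : TangentSpace I x) :
    TangentSpace I' (F x) :=
  (trivializationAt E' (TangentSpace I' : N → Type _) (F x)).symm (F x)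
      (d% (fun y : M ↦ (trivializationAt E' (TangentSpace I' : N → Type _) (F x)
        ⟨F y, V y⟩).2) x v)
    + g.leviCivita (extend E' (V x)) (F x) (mfderiv I I' F x v)

lemma trivialization_add {y₀ y : N} (hy : y ∈ (trivializationAt E' (TangentSpace I') y₀).baseSet)
    (v w : TangentSpace I' y) :
    (trivializationAt E' (TangentSpace I' : N → Type _) y₀ ⟨y, v + w⟩).2
      = (trivializationAt E' (TangentSpace I' : N → Type _) y₀ ⟨y, v⟩).2
        + (trivializationAt E' (TangentSpace I' : N → Type _) y₀ ⟨y, w⟩).2 :=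
  ((trivializationAt E' (TangentSpace I' : N → Type _) y₀).linear ℝ hy).map_add v w

lemma trivialization_smul {y₀ y : N} (hy : y ∈ (trivializationAt E' (TangentSpace I') y₀).baseSet)
    (c : ℝ) (v : TangentSpace I' y) :
    (trivializationAt E' (TangentSpace I' : N → Type _) y₀ ⟨y, c • v⟩).2
      = c • (trivializationAt E' (TangentSpace I' : N → Type _) y₀ ⟨y, v⟩).2 :=
  ((trivializationAt E' (TangentSpace I' : N → Type _) y₀).linear ℝ hy).map_smul c v

lemma trivialization_symm_add {y z : N}
    (hz : z ∈ (trivializationAt E' (TangentSpace I' : N → Type _) y).baseSet) (v w : E') :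
    (trivializationAt E' (TangentSpace I' : N → Type _) y).symm z (v + w)
      = (trivializationAt E' (TangentSpace I' : N → Type _) y).symm z v
        + (trivializationAt E' (TangentSpace I' : N → Type _) y).symm z w := by
  have := ((trivializationAt E' (TangentSpace I' : N → Type _) y).symmL ℝ z).map_add v w
  simpa only [Trivialization.symmL_apply _ hz] using this

lemma trivialization_symm_smul {y z : N}
    (hz : z ∈ (trivializationAt E' (TangentSpace I' : N → Type _) y).baseSet) (c : ℝ) (v : E') :
    (trivializationAt E' (TangentSpace I' : N → Type _) y).symm z (c • v)
      = c • (trivializationAt E' (TangentSpace I' : N → Type _) y).symm z v := by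
  have := ((trivializationAt E' (TangentSpace I' : N → Type _) y).symmL ℝ z).map_smul c v
  simpa only [Trivialization.symmL_apply _ hz] using this

lemma leviCivita_extend_add (g : SemiRiemannianMetric I' N) {y : N} (v w : TangentSpace I' y) :
    g.leviCivita (extend E' (v + w)) y
      = g.leviCivita (extend E' v) y + g.leviCivita (extend E' w) y := by
  have hv := mdifferentiableAt_extend I' E' v
  have hw := mdifferentiableAt_extend I' E' w
  rw [← g.leviCivita.isCovariantDerivativeOn.add hv hw]
  refine g.leviCivita.isCovariantDerivativeOnUniv.congr_of_eventuallyEq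
    (mdifferentiableAt_extend I' E' _) (mdifferentiableAt_add_section hv hw) Filter.univ_mem ?_
  filter_upwards [(trivializationAt E' (TangentSpace I' : N → Type _) y).open_baseSet.mem_nhds
    (FiberBundle.mem_baseSet_trivializationAt' y)] with z hz
  simp only [extend, Pi.add_apply,
    trivialization_add (FiberBundle.mem_baseSet_trivializationAt' y)]
  exact trivialization_symm_add hz _ _

lemma leviCivita_extend_smul (g : SemiRiemannianMetric I' N) {y : N} (c : ℝ)
    (v : TangentSpace I' y) :
    g.leviCivita (extend E' (c • v)) y = c • g.leviCivita (extend E' v) y := by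
  have hv := mdifferentiableAt_extend I' E' v
  rw [← g.leviCivita.isCovariantDerivativeOn.smul_const c hv]
  refine g.leviCivita.isCovariantDerivativeOnUniv.congr_of_eventuallyEq
    (mdifferentiableAt_extend I' E' _) (mdifferentiableAt_const.smul_section hv)
    Filter.univ_mem ?_
  filter_upwards [(trivializationAt E' (TangentSpace I' : N → Type _) y).open_baseSet.mem_nhds
    (FiberBundle.mem_baseSet_trivializationAt' y)] with z hz
  simp only [extend, Pi.smul_apply,
    trivialization_smul (FiberBundle.mem_baseSet_trivializationAt' y)]
  exact trivialization_symm_smul hz _ _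

section Along

variable {g : SemiRiemannianMetric I' N} {F : M → N} {V V' : Π x : M, TangentSpace I' (F x)}
  {x : M}

lemma mdiff_coord {V : Π x : M, TangentSpace I' (F x)}
    (hV : MDifferentiableAt I I'.tangent (fun y ↦ (⟨F y, V y⟩ : TangentBundle I' N)) x) :
    MDiffAt (fun y : M ↦ (trivializationAt E' (TangentSpace I' : N → Type _) (F x)
        ⟨F y, V y⟩).2) x :=
  ((mdifferentiableAt_totalSpace _ _).1 hV).2

lemma eventually_mem_baseSet (hF : ContinuousAt F x) :
    ∀ᶠ y in 𝓝 x, F y ∈ (trivializationAt E' (TangentSpace I' : N → Type _) (F x)).baseSet :=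
  hF.eventually ((trivializationAt E' (TangentSpace I' : N → Type _) (F x)).open_baseSet.mem_nhds
    (FiberBundle.mem_baseSet_trivializationAt' (F x)))

/-- Additivity of the covariant derivative along `F`. -/
lemma covDerivAlong_add (hF : MDifferentiableAt I I' F x)
    (hV : MDifferentiableAt I I'.tangent (fun y ↦ (⟨F y, V y⟩ : TangentBundle I' N)) x)
    (hV' : MDifferentiableAt I I'.tangent (fun y ↦ (⟨F y, V' y⟩ : TangentBundle I' N)) x)
    (v : TangentSpace I x) :
    covDerivAlong I g F (fun y ↦ V y + V' y) x v
      = covDerivAlong I g F V x v + covDerivAlong I g F V' x v := by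
  have e : d% (fun y : M ↦ (trivializationAt E' (TangentSpace I' : N → Type _) (F x)
        ⟨F y, V y + V' y⟩).2) x
      = d% ((fun y : M ↦ (trivializationAt E' (TangentSpace I' : N → Type _) (F x)
        ⟨F y, V y⟩).2) + fun y : M ↦ (trivializationAt E' (TangentSpace I' : N → Type _) (F x)
        ⟨F y, V' y⟩).2) x := by
    apply Filter.EventuallyEq.mfderiv_eq
    filter_upwards [eventually_mem_baseSet (I' := I') hF.continuousAt] with y hy
    exact trivialization_add hy _ _
  simp only [covDerivAlong, e, mvfderiv_add (mdiff_coord hV) (mdiff_coord hV'),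
    leviCivita_extend_add, add_apply,
    trivialization_symm_add (FiberBundle.mem_baseSet_trivializationAt' (F x))]
  abel

/-- Leibniz rule for the covariant derivative along `F`. -/
lemma covDerivAlong_smul (hF : MDifferentiableAt I I' F x) {f : M → ℝ} (hf : MDiffAt f x)
    (hV : MDifferentiableAt I I'.tangent (fun y ↦ (⟨F y, V y⟩ : TangentBundle I' N)) x)
    (v : TangentSpace I x) :
    covDerivAlong I g F (fun y ↦ f y • V y) x v
      = d% f x v • V x + f x • covDerivAlong I g F V x v := by
  have e : d% (fun y : M ↦ (trivializationAt E' (TangentSpace I' : N → Type _) (F x)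
        ⟨F y, f y • V y⟩).2) x
      = d% (f • (fun y : M ↦ (trivializationAt E' (TangentSpace I' : N → Type _) (F x)
        ⟨F y, V y⟩).2)) x := by
    apply Filter.EventuallyEq.mfderiv_eq
    filter_upwards [eventually_mem_baseSet (I' := I') hF.continuousAt] with y hy
    exact trivialization_smul hy _ _
  have hx : (trivializationAt E' (TangentSpace I' : N → Type _) (F x)).symm (F x)
      (trivializationAt E' (TangentSpace I' : N → Type _) (F x) ⟨F x, V x⟩).2 = V x := by
    exact extend_apply_self (F := E') (V x)
  simp only [covDerivAlong, e, mvfderiv_smul hf (mdiff_coord hV),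
    leviCivita_extend_smul,
    add_apply, smul_apply,
    ContinuousLinearMap.smulRight_apply,
    trivialization_symm_add (FiberBundle.mem_baseSet_trivializationAt' (F x)),
    trivialization_symm_smul (FiberBundle.mem_baseSet_trivializationAt' (F x)), hx]
  module

/-- For a vector field `W` on `N`, the derivative of `W ∘ F` along `F` is `∇^N_{F_* v} W`. -/
lemma covDerivAlong_comp (hF : MDifferentiableAt I I' F x) {W : Π y : N, TangentSpace I' y}
    (hW : MDiffAt (T% W) (F x)) (v : TangentSpace I x) :
    covDerivAlong I g F (fun y ↦ W (F y)) x v = g.leviCivita W (F x) (mfderiv I I' F x v) := by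
  have key (z : N) (u : TangentSpace I' z) (hW : MDiffAt (T% W) z) :
      covDerivAlong I' g (fun y ↦ y) W z u = g.leviCivita W z u := by
    have T : TensorialAt I' E' (fun W : Π y : N, TangentSpace I' y ↦
        covDerivAlong I' g (fun y ↦ y) W z u - g.leviCivita W z u) z := by
      constructor
      · intro f W hf hW
        rw [g.leviCivita.isCovariantDerivativeOn.leibniz hW hf]
        have := covDerivAlong_smul (g := g) (F := fun y : N ↦ y) (V := W) mdifferentiableAt_id hf
          hW u
        refine (congrArg (· - _) this).trans ?_
        simp
        module
      · intro W W' hW hW'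
        rw [g.leviCivita.isCovariantDerivativeOn.add hW hW']
        have := covDerivAlong_add (g := g) (F := fun y : N ↦ y) (V := W) (V' := W')
          mdifferentiableAt_id hW hW' u
        refine (congrArg (· - _) this).trans ?_
        simp
        module
    have := T.pointwise hW (mdifferentiableAt_extend I' E' (W z)) (by simp)
    rw [← sub_eq_zero, this]
    have e : d% (fun y : N ↦ (trivializationAt E' (TangentSpace I' : N → Type _) z
        ⟨y, extend E' (W z) y⟩).2) z = 0 := by
      rw [← mvfderiv_const (I := I')
        (trivializationAt E' (TangentSpace I' : N → Type _) z ⟨z, W z⟩).2]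
      apply Filter.EventuallyEq.mfderiv_eq
      filter_upwards [(trivializationAt E' (TangentSpace I' : N → Type _) z).open_baseSet.mem_nhds
        (FiberBundle.mem_baseSet_trivializationAt' z)] with y hy
      simp [extend, Trivialization.apply_mk_symm _ hy]
    have hs := ((trivializationAt E' (TangentSpace I' : N → Type _) z).symmL ℝ z).map_zero
    rw [Trivialization.symmL_apply _ (FiberBundle.mem_baseSet_trivializationAt' z)] at hs
    have hid : mfderiv I' I' (fun y : N ↦ y) z u = u := by
      rw [show (fun y : N ↦ y) = id from rfl, mfderiv_id]; rfl
    simp only [covDerivAlong, e, zero_apply, hs, extend_apply_self, hid]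
    simp
  rw [← key _ _ hW]
  have hc := mfderiv_comp_apply (I := I) x (mdiff_coord (F := fun y : N ↦ y) (I := I') (V := W) hW) hF v
  have hid : mfderiv I' I' (fun y : N ↦ y) (F x) (mfderiv I I' F x v) = mfderiv I I' F x v := by
    rw [show (fun y : N ↦ y) = id from rfl, mfderiv_id]; rfl
  simp only [covDerivAlong, hid]
  exact congrArg (fun w : E' ↦ (trivializationAt E' (TangentSpace I' : N → Type _) (F x)).symm (F x)
    w + g.leviCivita (extend E' (W (F x))) (F x) (mfderiv I I' F x v)) hc

end Along

/-- The section `F_* X` along `F` of a vector field `X` on `M`. -/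
def pushAlong (I : ModelWithCorners ℝ E H) (I' : ModelWithCorners ℝ E' H') (F : M → N)
    (X : Π x : M, TangentSpace I x) (x : M) : TangentSpace I' (F x) :=
  mfderiv I I' F x (X x)

/-- The second fundamental form of `F`:
`(∇F_*)(X, Y) = ∇^N_{F_* X} (F_* Y) - F_* (∇^M_X Y)`. -/
def secondFundamentalForm (h : SemiRiemannianMetric I M) (g : SemiRiemannianMetric I' N)
    (F : M → N) (X Y : Π x : M, TangentSpace I x) (x : M) : TangentSpace I' (F x) :=
  covDerivAlong I g F (pushAlong I I' F Y) x (X x)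
    - mfderiv I I' F x (h.leviCivita Y x (X x))

/-- `F` is `(P, Q)`-paraholomorphic: `F_* ∘ P = Q ∘ F_*`. -/
def IsParaholomorphic (P : AlmostProductStructure I M) (Q : AlmostProductStructure I' N)
    (F : M → N) : Prop :=
  ∀ (x : M) (v : TangentSpace I x), mfderiv I I' F x (P x v) = Q (F x) (mfderiv I I' F x v)

/-- `F` is `(P, Q)`-anti-paraholomorphic: `F_* ∘ P = - Q ∘ F_*`. -/
def IsAntiParaholomorphic (P : AlmostProductStructure I M) (Q : AlmostProductStructure I' N)
    (F : M → N) : Prop :=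
  ∀ (x : M) (v : TangentSpace I x), mfderiv I I' F x (P x v) = -Q (F x) (mfderiv I I' F x v)

end Maps

end

set_option linter.unusedSectionVars false

section CoordinateFields

variable {E : Type*} [NormedAddCommGroup E] [NormedSpace ℝ E]
  {M : Type*} [TopologicalSpace M] [ChartedSpace E M] [IsManifold 𝓘(ℝ, E) ∞ M]

lemma trivializationAt_self_apply {x : M} (v : TangentSpace 𝓘(ℝ, E) x) :
    (trivializationAt E (TangentSpace 𝓘(ℝ, E) : M → Type _) x ⟨x, v⟩).2 = v :=
  (tangentBundleCore 𝓘(ℝ, E) M).coordChange_self (achart E x) x (mem_chart_source E x) v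

lemma trivializationAt_apply_eq_mfderiv {x y : M} (hy : y ∈ (chartAt E x).source)
    (v : TangentSpace 𝓘(ℝ, E) y) :
    (trivializationAt E (TangentSpace 𝓘(ℝ, E) : M → Type _) x ⟨y, v⟩).2
      = mfderiv 𝓘(ℝ, E) 𝓘(ℝ, E) (extChartAt 𝓘(ℝ, E) x) y v := by
  have : (trivializationAt E (TangentSpace 𝓘(ℝ, E) : M → Type _) x).continuousLinearMapAt ℝ y v
      = mfderiv 𝓘(ℝ, E) 𝓘(ℝ, E) (extChartAt 𝓘(ℝ, E) x) y v := by
    rw [TangentBundle.continuousLinearMapAt_trivializationAt hy]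
    rfl
  rw [← this]
  exact (Trivialization.continuousLinearMapAt_apply_of_mem _ _ hy v).symm

lemma extend_eq_mfderiv_extChartAt_symm {x y : M} (hy : y ∈ (chartAt E x).source)
    (v : TangentSpace 𝓘(ℝ, E) x) :
    extend E v y = mfderiv 𝓘(ℝ, E) 𝓘(ℝ, E) (extChartAt 𝓘(ℝ, E) x).symm
      (extChartAt 𝓘(ℝ, E) x y) v := by
  have : (trivializationAt E (TangentSpace 𝓘(ℝ, E) : M → Type _) x).symmL ℝ y v
      = mfderiv 𝓘(ℝ, E) 𝓘(ℝ, E) (extChartAt 𝓘(ℝ, E) x).symm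
      (extChartAt 𝓘(ℝ, E) x y) v := by
    rw [TangentBundle.symmL_trivializationAt hy]
    simp only [modelWithCornersSelf_coe, Set.range_id, mfderivWithin_univ]
    rfl
  rw [extend, trivializationAt_self_apply]
  rw [← this]
  exact (Trivialization.symmL_apply (R := ℝ)
    (trivializationAt E (TangentSpace 𝓘(ℝ, E) : M → Type _) x) hy v).symm

/-- Coordinate vector fields of a chart commute at its centre. -/
lemma mlieBracket_extend {x : M} (v w : TangentSpace 𝓘(ℝ, E) x) :
    mlieBracket 𝓘(ℝ, E) (extend E v) (extend E w) x = 0 := by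
  have key (u : TangentSpace 𝓘(ℝ, E) x) :
      mpullbackWithin 𝓘(ℝ, E) 𝓘(ℝ, E) (extChartAt 𝓘(ℝ, E) x).symm (extend E u)
        (Set.range 𝓘(ℝ, E)) =ᶠ[𝓝 (extChartAt 𝓘(ℝ, E) x x)] fun _ ↦ (u : E) := by
    filter_upwards [extChartAt_target_mem_nhds (I := 𝓘(ℝ, E)) x] with z hz
    have hy : (extChartAt 𝓘(ℝ, E) x).symm z ∈ (chartAt E x).source := by
      simpa using (extChartAt 𝓘(ℝ, E) x).map_target hz
    have hi := isInvertible_mfderivWithin_extChartAt_symm hz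
    rw [mpullbackWithin_apply, extend_eq_mfderiv_extChartAt_symm hy]
    rw [(extChartAt 𝓘(ℝ, E) x).right_inv hz]
    simp only [modelWithCornersSelf_coe, Set.range_id, mfderivWithin_univ] at hi ⊢
    exact hi.inverse_apply_eq.2 rfl
  rw [← mlieBracketWithin_univ, mlieBracketWithin_apply]
  have h0 : lieBracketWithin ℝ
      (mpullbackWithin 𝓘(ℝ, E) 𝓘(ℝ, E) (extChartAt 𝓘(ℝ, E) x).symm (extend E v)
        (Set.range 𝓘(ℝ, E)))
      (mpullbackWithin 𝓘(ℝ, E) 𝓘(ℝ, E) (extChartAt 𝓘(ℝ, E) x).symm (extend E w)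
        (Set.range 𝓘(ℝ, E)))
      ((extChartAt 𝓘(ℝ, E) x).symm ⁻¹' Set.univ ∩ Set.range 𝓘(ℝ, E))
      (extChartAt 𝓘(ℝ, E) x x) = 0 := by
    refine (Filter.EventuallyEq.lieBracketWithin_vectorField_eq_nhds (key v) (key w)).trans ?_
    change fderivWithin ℝ (fun _ : E ↦ (w : E)) _ (extChartAt 𝓘(ℝ, E) x x) (v : E)
      - fderivWithin ℝ (fun _ : E ↦ (v : E)) _ (extChartAt 𝓘(ℝ, E) x x) (w : E) = 0
    rw [fderivWithin_fun_const, fderivWithin_fun_const]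
    exact sub_self (0 : E)
  rw [h0]
  exact map_zero _

end CoordinateFields

section Symmetry

variable {E : Type*} [NormedAddCommGroup E] [NormedSpace ℝ E] [FiniteDimensional ℝ E]
  {M : Type*} [TopologicalSpace M] [ChartedSpace E M] [IsManifold 𝓘(ℝ, E) ∞ M]
  {E' : Type*} [NormedAddCommGroup E'] [NormedSpace ℝ E'] [FiniteDimensional ℝ E']
  {N : Type*} [TopologicalSpace N] [ChartedSpace E' N] [IsManifold 𝓘(ℝ, E') ∞ N]
  {h : SemiRiemannianMetric 𝓘(ℝ, E) M} {g : SemiRiemannianMetric 𝓘(ℝ, E') N}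
  {F : M → N} {X Y : Π x : M, TangentSpace 𝓘(ℝ, E) x} {x : M}


lemma mdiff_pushAlong (hF : ContMDiff 𝓘(ℝ, E) 𝓘(ℝ, E') ∞ F) (hX : MDiffAt (T% X) x) :
    MDifferentiableAt 𝓘(ℝ, E) 𝓘(ℝ, E').tangent
      (fun y ↦ (⟨F y, pushAlong 𝓘(ℝ, E) 𝓘(ℝ, E') F X y⟩ : TangentBundle 𝓘(ℝ, E') N)) x := by
  have h1 : ContMDiff 𝓘(ℝ, E).tangent 𝓘(ℝ, E').tangent 1 (tangentMap 𝓘(ℝ, E) 𝓘(ℝ, E') F) :=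
    hF.contMDiff_tangentMap (by norm_cast)
  exact ((h1 _).mdifferentiableAt one_ne_zero).comp x hX

lemma contDiffAt_coord (hF : ContMDiff 𝓘(ℝ, E) 𝓘(ℝ, E') ∞ F) (x : M) :
    ContDiffAt ℝ ∞ (extChartAt 𝓘(ℝ, E') (F x) ∘ F ∘ (extChartAt 𝓘(ℝ, E) x).symm)
      (extChartAt 𝓘(ℝ, E) x x) := by
  have := (contMDiffAt_iff.1 (hF x)).2
  simpa only [modelWithCornersSelf_coe, Set.range_id, contDiffWithinAt_univ] using this

lemma fderiv_chart_comp {y : M} (hF : MDifferentiableAt 𝓘(ℝ, E) 𝓘(ℝ, E') F y)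
    (hy : y ∈ (chartAt E x).source) (hFy : F y ∈ (chartAt E' (F x)).source) (w : E) :
    fderiv ℝ (extChartAt 𝓘(ℝ, E') (F x) ∘ F ∘ (extChartAt 𝓘(ℝ, E) x).symm)
        (extChartAt 𝓘(ℝ, E) x y) w
      = mfderiv 𝓘(ℝ, E') 𝓘(ℝ, E') (extChartAt 𝓘(ℝ, E') (F x)) (F y)
        (mfderiv 𝓘(ℝ, E) 𝓘(ℝ, E') F y (mfderiv 𝓘(ℝ, E) 𝓘(ℝ, E) (extChartAt 𝓘(ℝ, E) x).symm
          (extChartAt 𝓘(ℝ, E) x y) w)) := by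
  have hys : y ∈ (extChartAt 𝓘(ℝ, E) x).source := by simpa using hy
  have hl : (extChartAt 𝓘(ℝ, E) x).symm (extChartAt 𝓘(ℝ, E) x y) = y :=
    (extChartAt 𝓘(ℝ, E) x).left_inv hys
  have hl' : (F ∘ (extChartAt 𝓘(ℝ, E) x).symm) (extChartAt 𝓘(ℝ, E) x y) = F y := congrArg F hl
  have hs : MDifferentiableAt 𝓘(ℝ, E) 𝓘(ℝ, E) (extChartAt 𝓘(ℝ, E) x).symm
      (extChartAt 𝓘(ℝ, E) x y) := by
    have := mdifferentiableWithinAt_extChartAt_symm (I := 𝓘(ℝ, E))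
      ((extChartAt 𝓘(ℝ, E) x).map_source hys)
    simpa only [modelWithCornersSelf_coe, Set.range_id, mdifferentiableWithinAt_univ] using this
  have hFs : MDifferentiableAt 𝓘(ℝ, E) 𝓘(ℝ, E') (F ∘ (extChartAt 𝓘(ℝ, E) x).symm)
      (extChartAt 𝓘(ℝ, E) x y) := MDifferentiableAt.comp_of_eq _ hF hs hl
  rw [← mfderiv_eq_fderiv, mfderiv_comp_of_eq (mdifferentiableAt_extChartAt hFy) hFs hl',
    mfderiv_comp_of_eq hF hs hl, hl', hl]
  rfl

lemma hasFDerivAt_fderiv_apply {f : E → E'} {z : E} (hf : ContDiffAt ℝ ∞ f z) (w : E) :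
    HasFDerivAt (fun z ↦ fderiv ℝ f z w) ((fderiv ℝ (fderiv ℝ f) z).flip w) z := by
  have hd : DifferentiableAt ℝ (fderiv ℝ f) z :=
    (hf.fderiv_right (m := 1) (by norm_cast)).differentiableAt one_ne_zero
  simpa using hd.hasFDerivAt.clm_apply (hasFDerivAt_const w z)

lemma mvfderiv_coord_pushAlong_extend (hF : ContMDiff 𝓘(ℝ, E) 𝓘(ℝ, E') ∞ F)
    (v w : TangentSpace 𝓘(ℝ, E) x) :
    d% (fun y : M ↦ (trivializationAt E' (TangentSpace 𝓘(ℝ, E') : N → Type _) (F x)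
        ⟨F y, pushAlong 𝓘(ℝ, E) 𝓘(ℝ, E') F (extend E w) y⟩).2) x v
      = fderiv ℝ (fderiv ℝ (extChartAt 𝓘(ℝ, E') (F x) ∘ F ∘ (extChartAt 𝓘(ℝ, E) x).symm))
        (extChartAt 𝓘(ℝ, E) x x) (v : E) (w : E) := by
  set f := extChartAt 𝓘(ℝ, E') (F x) ∘ F ∘ (extChartAt 𝓘(ℝ, E) x).symm
  have he : (fun y : M ↦ (trivializationAt E' (TangentSpace 𝓘(ℝ, E') : N → Type _) (F x)
        ⟨F y, pushAlong 𝓘(ℝ, E) 𝓘(ℝ, E') F (extend E w) y⟩).2)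
      =ᶠ[𝓝 x] (fun z : E ↦ fderiv ℝ f z (w : E)) ∘ extChartAt 𝓘(ℝ, E) x := by
    filter_upwards [(chartAt E x).open_source.mem_nhds (mem_chart_source E x),
      hF.continuous.continuousAt.eventually
        ((chartAt E' (F x)).open_source.mem_nhds (mem_chart_source E' (F x)))] with y hy hFy
    rw [trivializationAt_apply_eq_mfderiv hFy, pushAlong, extend_eq_mfderiv_extChartAt_symm hy]
    exact (fderiv_chart_comp ((hF y).mdifferentiableAt (by simp)) hy hFy w).symm
  have hd := hasFDerivAt_fderiv_apply (contDiffAt_coord hF x) (w : E)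
  have e : mfderiv 𝓘(ℝ, E) 𝓘(ℝ, E') ((fun z : E ↦ fderiv ℝ f z (w : E))
      ∘ extChartAt 𝓘(ℝ, E) x) x
      = (fderiv ℝ (fderiv ℝ f) (extChartAt 𝓘(ℝ, E) x x)).flip (w : E) := by
    rw [mfderiv_comp x hd.differentiableAt.mdifferentiableAt
      (mdifferentiableAt_extChartAt (mem_chart_source E x)), mfderiv_extChartAt_self,
      mfderiv_eq_fderiv, hd.fderiv]
    rfl
  exact congrArg (fun L : E →L[ℝ] E' ↦ L v) (he.mfderiv_eq.trans e)

/-- The operator `Y ↦ (v ↦ (∇F_*)(v, Y))` is tensorial. -/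
lemma secondFundamentalForm_tensorial (hF : ContMDiff 𝓘(ℝ, E) 𝓘(ℝ, E') ∞ F)
    (X : Π x : M, TangentSpace 𝓘(ℝ, E) x) :
    TensorialAt 𝓘(ℝ, E) E (fun Y ↦ secondFundamentalForm h g F X Y x) x where
  smul := by
    intro f Y hf hY
    have e : pushAlong 𝓘(ℝ, E) 𝓘(ℝ, E') F (f • Y)
        = fun y ↦ f y • pushAlong 𝓘(ℝ, E) 𝓘(ℝ, E') F Y y := by
      ext y; simp [pushAlong]
    simp only [secondFundamentalForm]
    rw [e, covDerivAlong_smul ((hF x).mdifferentiableAt (by simp)) hf (mdiff_pushAlong hF hY),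
      h.leviCivita.isCovariantDerivativeOn.leibniz hY hf]
    simp [pushAlong]
    module
  add := by
    intro Y Y' hY hY'
    have e : pushAlong 𝓘(ℝ, E) 𝓘(ℝ, E') F (Y + Y')
        = fun y ↦ pushAlong 𝓘(ℝ, E) 𝓘(ℝ, E') F Y y + pushAlong 𝓘(ℝ, E) 𝓘(ℝ, E') F Y' y := by
      ext y; simp [pushAlong]
    simp only [secondFundamentalForm]
    rw [e, covDerivAlong_add ((hF x).mdifferentiableAt (by simp)) (mdiff_pushAlong hF hY)
      (mdiff_pushAlong hF hY'), h.leviCivita.isCovariantDerivativeOn.add hY hY']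
    simp
    abel

lemma leviCivita_extend_comm (h : SemiRiemannianMetric 𝓘(ℝ, E) M) (v w : TangentSpace 𝓘(ℝ, E) x) :
    h.leviCivita (extend E w) x v = h.leviCivita (extend E v) x w := by
  have := h.leviCivita_torsion (mdifferentiableAt_extend 𝓘(ℝ, E) E v)
    (mdifferentiableAt_extend 𝓘(ℝ, E) E w)
  rwa [mlieBracket_extend, sub_eq_zero, extend_apply_self, extend_apply_self] at this

/-- The second fundamental form of a smooth map is symmetric. -/
lemma secondFundamentalForm_symm (hF : ContMDiff 𝓘(ℝ, E) 𝓘(ℝ, E') ∞ F)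
    (hX : MDiffAt (T% X) x) (hY : MDiffAt (T% Y) x) :
    secondFundamentalForm h g F X Y x = secondFundamentalForm h g F Y X x := by
  rw [(secondFundamentalForm_tensorial (h := h) (g := g) hF X).pointwise hY
      (mdifferentiableAt_extend 𝓘(ℝ, E) E (Y x)) (by simp),
    (secondFundamentalForm_tensorial (h := h) (g := g) hF Y).pointwise hX
      (mdifferentiableAt_extend 𝓘(ℝ, E) E (X x)) (by simp)]
  simp only [secondFundamentalForm, covDerivAlong, mvfderiv_coord_pushAlong_extend hF,
    leviCivita_extend_comm h (X x) (Y x)]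
  rw [(contDiffAt_coord hF x).isSymmSndFDerivAt (by simp; norm_cast) (X x : E) (Y x : E)]
  congr 2
  simp only [pushAlong, extend_apply_self]
  exact leviCivita_extend_comm g _ _

end Symmetry

section ProductRule

variable {E : Type*} [NormedAddCommGroup E] [NormedSpace ℝ E] [FiniteDimensional ℝ E]
  {M : Type*} [TopologicalSpace M] [ChartedSpace E M] [IsManifold 𝓘(ℝ, E) ∞ M]
  {E' : Type*} [NormedAddCommGroup E'] [NormedSpace ℝ E'] [FiniteDimensional ℝ E']
  {N : Type*} [TopologicalSpace N] [ChartedSpace E' N] [IsManifold 𝓘(ℝ, E') ∞ N]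
  {g : SemiRiemannianMetric 𝓘(ℝ, E') N} {Q : AlmostProductStructure 𝓘(ℝ, E') N}
  {F : M → N} {x : M}

lemma mvfderiv_clm_apply {A : M → E' →L[ℝ] E'} {u : M → E'} (hA : MDiffAt A x) (hu : MDiffAt u x)
    (v : TangentSpace 𝓘(ℝ, E) x) :
    d% (fun y ↦ A y (u y)) x v = d% (fun y ↦ A y (u x)) x v + A x (d% u x v) := by
  have key {w : M → E'} (hw : MDiffAt w x) :
      d% (fun y ↦ A y (w y)) x v = A x (d% w x v) + d% A x v (w x) := by
    have h2 := hA.hasMFDerivAt.2.clm_apply hw.hasMFDerivAt.2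
    have e : HasMFDerivAt 𝓘(ℝ, E) 𝓘(ℝ, E') (fun y ↦ A y (w y)) x _ :=
      ⟨(hA.clm_apply hw).continuousAt, h2⟩
    have := congrArg (fun L : E →L[ℝ] E' ↦ L v) e.mfderiv
    refine this.trans ?_
    have hl : (extChartAt 𝓘(ℝ, E) x).symm (extChartAt 𝓘(ℝ, E) x x) = x := by simp
    simp only [writtenInExtChartAt, extChartAt_model_space_eq_id, PartialEquiv.refl_coe,
      Function.comp_apply, hl, id_eq]
    rfl
  rw [key hu, key (mdifferentiableAt_const (c := u x)), mvfderiv_const]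
  simp [add_comm]

/-- The endomorphism field `Q` in the trivialization at `y₀`. -/
noncomputable def AlmostProductStructure.coord (Q : AlmostProductStructure 𝓘(ℝ, E') N) (y₀ y : N) :
    E' →L[ℝ] E' :=
  ContinuousLinearMap.inCoordinates E' (TangentSpace 𝓘(ℝ, E') : N → Type _) E'
    (TangentSpace 𝓘(ℝ, E') : N → Type _) y₀ y y₀ y (Q y)

lemma AlmostProductStructure.mdiff_coord (Q : AlmostProductStructure 𝓘(ℝ, E') N) (y₀ : N) :
    MDiffAt (Q.coord y₀) y₀ :=
  ((mdifferentiableAt_hom_bundle _).1 ((Q.contMDiff y₀).mdifferentiableAt (by simp))).2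

lemma AlmostProductStructure.coord_apply (Q : AlmostProductStructure 𝓘(ℝ, E') N) {y₀ y : N}
    (hy : y ∈ (chartAt E' y₀).source) (v : TangentSpace 𝓘(ℝ, E') y) :
    Q.coord y₀ y (trivializationAt E' (TangentSpace 𝓘(ℝ, E') : N → Type _) y₀ ⟨y, v⟩).2
      = (trivializationAt E' (TangentSpace 𝓘(ℝ, E') : N → Type _) y₀ ⟨y, Q y v⟩).2 := by
  rw [coord, ContinuousLinearMap.inCoordinates_eq (by exact hy) (by exact hy)]
  have : (trivializationAt E' (TangentSpace 𝓘(ℝ, E') : N → Type _) y₀ ⟨y, v⟩).2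
    = (trivializationAt E' (TangentSpace 𝓘(ℝ, E') : N → Type _) y₀).continuousLinearEquivAt ℝ y
      hy v := rfl
  rw [this]
  simp only [ContinuousLinearMap.comp_apply, ContinuousLinearEquiv.coe_coe,
    ContinuousLinearEquiv.symm_apply_apply]
  rfl

/-- Product rule for the covariant derivative along `F` of `Q V`. -/
lemma covDerivAlong_structure_apply (hF : MDifferentiableAt 𝓘(ℝ, E) 𝓘(ℝ, E') F x)
    {V : Π x : M, TangentSpace 𝓘(ℝ, E') (F x)}
    (hV : MDifferentiableAt 𝓘(ℝ, E) 𝓘(ℝ, E').tangent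
      (fun y ↦ (⟨F y, V y⟩ : TangentBundle 𝓘(ℝ, E') N)) x) (v : TangentSpace 𝓘(ℝ, E) x) :
    covDerivAlong 𝓘(ℝ, E) g F (fun y ↦ Q (F y) (V y)) x v
      = nablaStructure g Q (F x) (mfderiv 𝓘(ℝ, E) 𝓘(ℝ, E') F x v) (V x)
        + Q (F x) (covDerivAlong 𝓘(ℝ, E) g F V x v) := by
  have hW := mdifferentiableAt_extend 𝓘(ℝ, E') E' (V x)
  have h1 := covDerivAlong_comp (g := g) hF (Q.mdiff_apply hW) v
  have h2 := nablaStructure_apply g Q (mfderiv 𝓘(ℝ, E) 𝓘(ℝ, E') F x v) hW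
  rw [extend_apply_self] at h2
  rw [h2, ← h1]
  set A : M → E' →L[ℝ] E' := fun y ↦ Q.coord (F x) (F y)
  set u : M → E' := fun y ↦ (trivializationAt E' (TangentSpace 𝓘(ℝ, E') : N → Type _) (F x)
        ⟨F y, V y⟩).2 with hu
  have hAd : MDiffAt A x := (Q.mdiff_coord (F x)).comp x hF
  have hud : MDiffAt u x := mdiff_coord hV
  have hnear := hF.continuousAt.eventually
    ((chartAt E' (F x)).open_source.mem_nhds (mem_chart_source E' (F x)))
  have e1 : (fun y : M ↦ (trivializationAt E' (TangentSpace 𝓘(ℝ, E') : N → Type _) (F x)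
        ⟨F y, Q (F y) (V y)⟩).2) =ᶠ[𝓝 x] fun y ↦ A y (u y) := by
    filter_upwards [hnear] with y hy
    exact (Q.coord_apply hy _).symm
  have e2 : (fun y : M ↦ (trivializationAt E' (TangentSpace 𝓘(ℝ, E') : N → Type _) (F x)
        ⟨F y, Q (F y) (extend E' (V x) (F y))⟩).2) =ᶠ[𝓝 x] fun y ↦ A y (u x) := by
    filter_upwards [hnear] with y hy
    refine (Q.coord_apply hy _).symm.trans ?_
    rw [extend, Trivialization.apply_mk_symm _ (by exact hy)]
  have d1 : d% (fun y : M ↦ (trivializationAt E' (TangentSpace 𝓘(ℝ, E') : N → Type _) (F x)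
        ⟨F y, Q (F y) (V y)⟩).2) x v
      = d% (fun y : M ↦ (trivializationAt E' (TangentSpace 𝓘(ℝ, E') : N → Type _) (F x)
        ⟨F y, Q (F y) (extend E' (V x) (F y))⟩).2) x v + A x (d% u x v) := by
    have a1 : _ = d% (fun y ↦ A y (u y)) x v := congrArg (fun L : E →L[ℝ] E' ↦ L v) e1.mfderiv_eq
    have a2 : _ = d% (fun y ↦ A y (u x)) x v := congrArg (fun L : E →L[ℝ] E' ↦ L v) e2.mfderiv_eq
    exact a1.trans ((mvfderiv_clm_apply hAd hud v).trans (congrArg (· + A x (d% u x v)) a2.symm))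
  have hQ (w : E') : (trivializationAt E' (TangentSpace 𝓘(ℝ, E') : N → Type _) (F x)).symm (F x)
      (A x w) = Q (F x) ((trivializationAt E' (TangentSpace 𝓘(ℝ, E') : N → Type _) (F x)).symm
        (F x) w) := by
    have hm := FiberBundle.mem_baseSet_trivializationAt' (F := E')
      (E := (TangentSpace 𝓘(ℝ, E') : N → Type _)) (F x)
    have := Q.coord_apply (mem_chart_source E' (F x))
      ((trivializationAt E' (TangentSpace 𝓘(ℝ, E') : N → Type _) (F x)).symm (F x) w)
    rw [Trivialization.apply_mk_symm _ hm] at this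
    rw [show A x w = _ from this]
    exact Trivialization.symm_apply_apply_mk _ hm _
  simp only [covDerivAlong, d1, hu,
    trivialization_symm_add (FiberBundle.mem_baseSet_trivializationAt' (F x)), hQ, map_add,
    extend_apply_self]
  abel

end ProductRule

section Paraholomorphic

variable {E : Type*} [NormedAddCommGroup E] [NormedSpace ℝ E] [FiniteDimensional ℝ E]
  {M : Type*} [TopologicalSpace M] [ChartedSpace E M] [IsManifold 𝓘(ℝ, E) ∞ M]
  {E' : Type*} [NormedAddCommGroup E'] [NormedSpace ℝ E'] [FiniteDimensional ℝ E']
  {N : Type*} [TopologicalSpace N] [ChartedSpace E' N] [IsManifold 𝓘(ℝ, E') ∞ N]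
  {h : SemiRiemannianMetric 𝓘(ℝ, E) M} {P : AlmostProductStructure 𝓘(ℝ, E) M}
  {g : SemiRiemannianMetric 𝓘(ℝ, E') N} {Q : AlmostProductStructure 𝓘(ℝ, E') N}
  {F : M → N} {X Y : Π x : M, TangentSpace 𝓘(ℝ, E) x} {x : M} {lam : ℝ}

lemma nablaStructure_smul_left (c : ℝ) (v w : TangentSpace 𝓘(ℝ, E) x) :
    nablaStructure h P x (c • v) w = c • nablaStructure h P x v w :=
  map_smul (TensorialAt.mkHom _ x (nablaStructure_tensorial h P x) w) c v

lemma nablaStructure_smul_right (c : ℝ) (v w : TangentSpace 𝓘(ℝ, E) x) :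
    nablaStructure h P x v (c • w) = c • nablaStructure h P x v w :=
  congrArg (fun L : TangentSpace 𝓘(ℝ, E) x →L[ℝ] TangentSpace 𝓘(ℝ, E) x ↦ L v)
    (map_smul (TensorialAt.mkHom _ x (nablaStructure_tensorial h P x)) c w)

/-- Differentiating `P² = Id`: the endomorphism `∇_v P` anticommutes with `P`. -/
lemma nablaStructure_apply_structure (v w : TangentSpace 𝓘(ℝ, E) x) :
    nablaStructure h P x v (P x w) = -P x (nablaStructure h P x v w) := by
  have hW := mdifferentiableAt_extend 𝓘(ℝ, E) E w
  have h1 := nablaStructure_apply h P v (P.mdiff_apply hW)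
  have h2 := nablaStructure_apply h P v hW
  simp only [P.sq, extend_apply_self] at h1 h2
  change _ = h.leviCivita (extend E w) x v - _ at h1
  rw [h1, h2, map_sub, P.sq]
  abel

lemma secondFundamentalForm_apply_structure (hF : ContMDiff 𝓘(ℝ, E) 𝓘(ℝ, E') ∞ F)
    (hPQ : ∀ (y : M) (v : TangentSpace 𝓘(ℝ, E) y),
      mfderiv 𝓘(ℝ, E) 𝓘(ℝ, E') F y (P y v) = lam • Q (F y) (mfderiv 𝓘(ℝ, E) 𝓘(ℝ, E') F y v))
    (X : Π x : M, TangentSpace 𝓘(ℝ, E) x) (hY : MDiffAt (T% Y) x) :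
    secondFundamentalForm h g F X (fun y ↦ P y (Y y)) x
      = lam • nablaStructure g Q (F x) (pushAlong 𝓘(ℝ, E) 𝓘(ℝ, E') F X x)
          (pushAlong 𝓘(ℝ, E) 𝓘(ℝ, E') F Y x)
        + lam • Q (F x) (secondFundamentalForm h g F X Y x)
        - mfderiv 𝓘(ℝ, E) 𝓘(ℝ, E') F x (nablaStructure h P x (X x) (Y x)) := by
  have hFx : MDifferentiableAt 𝓘(ℝ, E) 𝓘(ℝ, E') F x := (hF x).mdifferentiableAt (by simp)
  have hl : MDiffAt (fun _ : M ↦ lam) x := mdifferentiableAt_const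
  have hlY := hl.smul_section hY
  have e1 : pushAlong 𝓘(ℝ, E) 𝓘(ℝ, E') F (fun y ↦ P y (Y y))
      = fun y ↦ Q (F y) (pushAlong 𝓘(ℝ, E) 𝓘(ℝ, E') F ((fun _ : M ↦ lam) • Y) y) := by
    ext y; simp [pushAlong, hPQ]
  have e2 : pushAlong 𝓘(ℝ, E) 𝓘(ℝ, E') F ((fun _ : M ↦ lam) • Y)
      = fun y ↦ lam • pushAlong 𝓘(ℝ, E) 𝓘(ℝ, E') F Y y := by
    ext y; simp [pushAlong]
  have h1 := covDerivAlong_structure_apply (g := g) (Q := Q) hFx (mdiff_pushAlong hF hlY) (X x)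
  rw [← e1, e2, covDerivAlong_smul hFx hl (mdiff_pushAlong hF hY), mvfderiv_const,
    nablaStructure_smul_right] at h1
  simp only [secondFundamentalForm, h1, nablaStructure_apply h P (X x) hY, map_sub, hPQ]
  simp only [pushAlong, zero_apply, zero_smul, zero_add, map_smul]
  module

end Paraholomorphic

theorem mainTheorem8
    {E : Type*} [NormedAddCommGroup E] [NormedSpace ℝ E] [FiniteDimensional ℝ E]
    {M : Type*} [TopologicalSpace M] [ChartedSpace E M] [IsManifold 𝓘(ℝ, E) ∞ M]
    {E' : Type*} [NormedAddCommGroup E'] [NormedSpace ℝ E'] [FiniteDimensional ℝ E']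
    {N : Type*} [TopologicalSpace N] [ChartedSpace E' N] [IsManifold 𝓘(ℝ, E') ∞ N]
    (h : SemiRiemannianMetric 𝓘(ℝ, E) M) (P : AlmostProductStructure 𝓘(ℝ, E) M)
    (g : SemiRiemannianMetric 𝓘(ℝ, E') N) (Q : AlmostProductStructure 𝓘(ℝ, E') N)
    (hP : IsPure h P ∨ IsHyperbolic h P) (hQ : IsPure g Q ∨ IsHyperbolic g Q)
    (F : M → N) (hF : ContMDiff 𝓘(ℝ, E) 𝓘(ℝ, E') ∞ F)
    (lam : ℝ)
    (hlam : (lam = 1 ∧ IsParaholomorphic P Q F) ∨ (lam = -1 ∧ IsAntiParaholomorphic P Q F))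
    (U : Set M) (hU : IsOpen U) (X Y : Π x : M, TangentSpace 𝓘(ℝ, E) x)
    (hX : CMDiff[U] ∞ (T% X)) (hY : CMDiff[U] ∞ (T% Y)) (x : M) (hx : x ∈ U) :
    secondFundamentalForm h g F (fun y ↦ P y (X y)) (fun y ↦ P y (Y y)) x
        = secondFundamentalForm h g F X Y x
          + nablaStructure g Q (F x)
              (Q (F x) (pushAlong 𝓘(ℝ, E) 𝓘(ℝ, E') F X x)) (pushAlong 𝓘(ℝ, E) 𝓘(ℝ, E') F Y x)
          - nablaStructure g Q (F x)
              (pushAlong 𝓘(ℝ, E) 𝓘(ℝ, E') F Y x) (Q (F x) (pushAlong 𝓘(ℝ, E) 𝓘(ℝ, E') F X x))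
          - mfderiv 𝓘(ℝ, E) 𝓘(ℝ, E') F x
              (nablaStructure h P x (P x (X x)) (Y x) - nablaStructure h P x (Y x) (P x (X x)))
      ∧ secondFundamentalForm h g F (fun y ↦ P y (X y)) (fun y ↦ P y (X y)) x
        = secondFundamentalForm h g F X X x
          + tensorS g Q (F x)
              (Q (F x) (pushAlong 𝓘(ℝ, E) 𝓘(ℝ, E') F X x)) (pushAlong 𝓘(ℝ, E) 𝓘(ℝ, E') F X x)
          - mfderiv 𝓘(ℝ, E) 𝓘(ℝ, E') F x (tensorS h P x (P x (X x)) (X x))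
      ∧ secondFundamentalForm h g F (fun y ↦ P y (X y)) (fun y ↦ P y (X y)) x
        = secondFundamentalForm h g F X X x
          + Q (F x) (tensorS g Q (F x)
                (pushAlong 𝓘(ℝ, E) 𝓘(ℝ, E') F X x) (pushAlong 𝓘(ℝ, E) 𝓘(ℝ, E') F X x)
              - lam • mfderiv 𝓘(ℝ, E) 𝓘(ℝ, E') F x (tensorS h P x (X x) (X x))) := by
  have hlam2 : lam * lam = 1 := by rcases hlam with ⟨rfl, -⟩ | ⟨rfl, -⟩ <;> norm_num
  have hPQ : ∀ (y : M) (v : TangentSpace 𝓘(ℝ, E) y), mfderiv 𝓘(ℝ, E) 𝓘(ℝ, E') F y (P y v)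
      = lam • Q (F y) (mfderiv 𝓘(ℝ, E) 𝓘(ℝ, E') F y v) := by
    rcases hlam with ⟨rfl, H⟩ | ⟨rfl, H⟩ <;> intro y v <;> simp [H y v]
  have main {X Y : Π x : M, TangentSpace 𝓘(ℝ, E) x} (hX : MDiffAt (T% X) x)
      (hY : MDiffAt (T% Y) x) :
      secondFundamentalForm h g F (fun y ↦ P y (X y)) (fun y ↦ P y (Y y)) x
        = secondFundamentalForm h g F X Y x
          + nablaStructure g Q (F x)
              (Q (F x) (pushAlong 𝓘(ℝ, E) 𝓘(ℝ, E') F X x)) (pushAlong 𝓘(ℝ, E) 𝓘(ℝ, E') F Y x)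
          - nablaStructure g Q (F x)
              (pushAlong 𝓘(ℝ, E) 𝓘(ℝ, E') F Y x) (Q (F x) (pushAlong 𝓘(ℝ, E) 𝓘(ℝ, E') F X x))
          - mfderiv 𝓘(ℝ, E) 𝓘(ℝ, E') F x
              (nablaStructure h P x (P x (X x)) (Y x) - nablaStructure h P x (Y x) (P x (X x))) := by
    have hp : pushAlong 𝓘(ℝ, E) 𝓘(ℝ, E') F (fun y ↦ P y (X y)) x
        = lam • Q (F x) (pushAlong 𝓘(ℝ, E) 𝓘(ℝ, E') F X x) := hPQ x (X x)
    rw [secondFundamentalForm_apply_structure hF hPQ _ hY,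
      secondFundamentalForm_symm hF (P.mdiff_apply hX) hY,
      secondFundamentalForm_apply_structure hF hPQ _ hX, hp, nablaStructure_smul_left,
      secondFundamentalForm_symm hF hY hX, nablaStructure_apply_structure,
      nablaStructure_apply_structure]
    simp only [map_add, map_sub, map_smul, map_neg, hPQ, Q.sq, smul_add, smul_sub, smul_smul, hlam2,
      one_smul]
    module
  have hXx : MDiffAt (T% X) x :=
    (hX.contMDiffAt (hU.mem_nhds hx)).mdifferentiableAt (by simp)
  have hYx : MDiffAt (T% Y) x :=
    (hY.contMDiffAt (hU.mem_nhds hx)).mdifferentiableAt (by simp)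
  refine ⟨main hXx hYx, ?_, ?_⟩
  · rw [main hXx hXx]
    simp only [tensorS, nablaStructure_apply_structure, P.sq, Q.sq, map_add, map_sub, map_neg]
    abel
  · rw [main hXx hXx]
    simp only [tensorS, nablaStructure_apply_structure, map_add, map_sub, map_neg, map_smul, hPQ,
      Q.sq, smul_add, smul_smul, hlam2, one_smul]
    module
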